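/- **Setting (Rasch model).** There are $n$ users with parameters $\theta^*_1,\dots,\theta^*_n\in\mathbb R$ and $m\ge 2$ items with parameters $\beta^*_1,\dots,\beta^*_m\in\mathbb R$, normalized by $\sum_i\beta^*_i=0$; let $p\in(0,1]$. The variables $A_{li}\in\{0,1\}$ (item $i$ is assigned to user $l$) and $X_{li}\in\{0,1\}$ (response of user $l$ to item $i$, observed only if $A_{li}=1$) are mutually independent over all $l\in[n]$, $i\in[m]$, with $$\Pr(A_{li}=1)=p,\qquad \Pr(X_{li}=1)=\frac{e^{\theta^*_l}}{e^{\theta^*_l}+e^{\beta^*_i}} .$$ Put $\kappa=\max_{i,j}|\beta^*_i-\beta^*_j|$ and $\gamma=\min_{l\in[n],\,i\ne j}\mathbb E[X_{li}(1-X_{lj})]$, and write $a\lor b=\max(a,b)$, $a\land b=\min(a,b)$. **Spectral estimate.** With $d=\tfrac32 mnp^2$ let $M_{ij}=\frac1d\sum_{l=1}^n A_{li}A_{lj}X_{li}(1-X_{lj})$ for $i\ne j$ and $M_{ii}=1-\sum_{k\ne i}M_{ik}$. If $M$ is a transition matrix with a unique stationary distribution $\pi$, and $\pi$ is entrywise positive,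 the spectral estimate is said to be well defined and is $\beta_i=\log\pi_i-\frac1m\sum_{k=1}^m\log\pi_k$. **Theorem.** There exist absolute constants $C_0,C_1,C_2,C_3,C_4>0$ such that, for all $n$, $m\ge2$, $p$, $\theta^*$, $\beta^*$ as above, if $$np^2 > C_0\log m \;\lor\; \frac{C_1^2}{\gamma}\left(\log np^2 \lor \log m\right) \;\lor\; \frac{e^{4\kappa}C_2}{\gamma^3}\left(\log np^2 \lor \log m\right) \;\lor\; \frac{C_4e^{6\kappa}}{\gamma^4}\left(\log np^2 \lor \log m\right),$$ then with probability at least $$1 - 2\exp\left(-\frac{np^2}{24}\right) - 2\left((np^2)^{-10}\land m^{-10}\right) - \left(e^{-40m}\land (np^2)^{-40}\right)$$ the spectral estimate $\beta$ is well defined and $$\lVert \beta-\beta^*\rVert_\infty \le \frac{4e^{2\kappa}}{\frac{\gamma}{3}\left(1-\frac{\gamma}{12e^{2\kappa}}\right)}\left(\frac{2C_1}{\sqrt\gamma}\,\frac{\sqrt{\log np^2\lor\log m}}{\sqrt{np^2}} + \frac{1+\frac{\gamma}{12e^{2\kappa}}}{\frac{\gamma}{6e^{2\kappa}}}\,\frac{C_3\sqrt{\frac{\log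 np^2}{m}\lor 1}}{\sqrt{np^2}}\right).$$ -/

import Mathlib

open MeasureTheory ProbabilityTheory

noncomputable section

/-- The real indicator in `{0, 1}` of a Boolean. -/
def bit (b : Bool) : ℝ := if b then 1 else 0

/-- The Rasch model with `n` users, `m` items, user parameters `θ`, item parameters `β` and uniform
sampling with probability `p`.  `A l i` tells whether item `i` is assigned to user `l`, and `X l i`
is the response of user `l` to item `i`; only the responses with `A l i = true` are ever used below.
All the `A l i` and `X l i` are mutually independent Bernoulli variables, with
`P(A l i = 1) = p` and `P(X l i = 1) = exp (θ l) / (exp (θ l) + exp (β i))`. -/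
structure IsRaschModel {Ω : Type*} [MeasurableSpace Ω] (μ : Measure Ω) {n m : ℕ} (p : ℝ)
    (θ : Fin n → ℝ) (β : Fin m → ℝ) (A X : Fin n → Fin m → Ω → Bool) : Prop where
  measurable_assignment : ∀ l i, Measurable (A l i)
  measurable_response : ∀ l i, Measurable (X l i)
  prob_assignment : ∀ l i, μ.real {ω | A l i ω = true} = p
  prob_response : ∀ l i, μ.real {ω | X l i ω = true} =
    Real.exp (θ l) / (Real.exp (θ l) + Real.exp (β i))
  indep : iIndepFun (β := fun _ : (Fin n × Fin m) ⊕ (Fin n × Fin m) => Bool)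
    (Sum.elim (fun e => A e.1 e.2) (fun e => X e.1 e.2)) μ

/-- `κ = max_{i,j} |β i - β j|`, the dynamic range of the item parameters. -/
def itemRange {m : ℕ} (β : Fin m → ℝ) : ℝ :=
  ⨆ i : Fin m, ⨆ j : Fin m, |β i - β j|

/-- `γ = min_{l, i ≠ j} E[X l i * (1 - X l j)]`. -/
def minDiscordance {Ω : Type*} [MeasurableSpace Ω] (μ : Measure Ω) {n m : ℕ}
    (X : Fin n → Fin m → Ω → Bool) : ℝ :=
  ⨅ l : Fin n, ⨅ e : {e : Fin m × Fin m // e.1 ≠ e.2},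
    ∫ ω, bit (X l e.1.1 ω) * (1 - bit (X l e.1.2 ω)) ∂μ

/-- The matrix of the spectral algorithm built from one data set `(a, x)`, with normalization `d`:
`M i j = (1 / d) * ∑ l, a l i * a l j * x l i * (1 - x l j)` for `i ≠ j`, and the diagonal makes the
rows sum to one. -/
def spectralMatrix {n m : ℕ} (d : ℝ) (a x : Fin n → Fin m → Bool) : Matrix (Fin m) (Fin m) ℝ :=
  let off : Fin m → Fin m → ℝ := fun i j =>
    (1 / d) * ∑ l : Fin n, bit (a l i) * bit (a l j) * (bit (x l i) * (1 - bit (x l j)))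
  Matrix.of fun i j => if i = j then 1 - ∑ k ∈ Finset.univ.erase i, off i k else off i j

/-- `π` is a stationary probability vector of `M`. -/
def IsStationaryDistribution {m : ℕ} (M : Matrix (Fin m) (Fin m) ℝ) (π : Fin m → ℝ) : Prop :=
  π ∈ stdSimplex ℝ (Fin m) ∧ Matrix.vecMul π M = π

/-- `b` is the spectral estimate of the item parameters obtained from the matrix `M`: this asserts
that the estimate is well defined (`M` is a transition matrix with exactly one stationary
distribution `π`, and `π` is positive) and that `b i = log (π i) - (1 / m) * ∑ k, log (π k)`. -/
def IsSpectralEstimate {m : ℕ} (M : Matrix (Fin m) (Fin m) ℝ) (b : Fin m → ℝ) : Prop :=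
  M ∈ Matrix.rowStochastic ℝ (Fin m) ∧
    ∃ π : Fin m → ℝ, IsStationaryDistribution M π ∧
      (∀ π', IsStationaryDistribution M π' → π' = π) ∧
      (∀ i, 0 < π i) ∧
      ∀ i, b i = Real.log (π i) - (1 / (m : ℝ)) * ∑ k, Real.log (π k)

end

/-! Every off-diagonal entry of `M` is a normalized count of discordant pairs, so it can be
controlled entry by entry. Its mean is `P i j`, where `P` is in detailed balance with `w = exp ∘ βs`
(`exp_mul_discordance_comm`) and `P i j` is at least `(2γ/3)/m`.

Each count is a sum of independent indicators with total mean at most `N`. Chernoff's bound and a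
union bound over pairs (`measureReal_exists_count_deviation_le`) put all counts within `2 * t * N`
of their means, for `t = √(12 L / N)`, outside an event of probability at most `2 exp(-10 L)`. Then
`M` is entrywise positive and stochastic, so the estimate is well defined
(`exists_unique_stationary`).

The error is bounded by a maximum principle (`stationary_ratio_sub_le`). The balance equations for
`π`, read at the maximum and the minimum of `π / w`, force this ratio to be nearly constant, since
every state communicates directly with every other at rate of order `1/m`. Taking logarithms and
centering gives `‖b - βs‖ ≤ 16 exp κ * t / γ`, which the first term of the stated bound already
dominates. -/

/-! ### Stationary vectors of positive stochastic matrices and their perturbation. -/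

section Stochastic

variable {ι : Type*} [Fintype ι]

/-- A nonzero nonnegative left fixed vector of an entrywise positive matrix is positive. -/
lemma pos_of_vecMul_eq_self {M : Matrix ι ι ℝ} (hpos : ∀ i j, 0 < M i j) {v : ι → ℝ}
    (hv : Matrix.vecMul v M = v) (h0 : ∀ i, 0 ≤ v i) (hne : v ≠ 0) (j : ι) : 0 < v j := by
  obtain ⟨i, hi⟩ := Function.ne_iff.1 hne
  have hi' : 0 < v i := lt_of_le_of_ne (h0 i) (Ne.symm hi)
  rw [← hv]
  exact Finset.sum_pos' (fun k _ => mul_nonneg (h0 k) (hpos k j).le)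
    ⟨i, Finset.mem_univ i, mul_pos hi' (hpos i j)⟩

/-- Entrywise perturbation of the stationary vector of a reversible chain: if `P` satisfies
detailed balance with respect to `w`, has off-diagonal entries at least `g / |ι|`, and `M` is
within `ε / |ι|` of `P` off the diagonal, then the ratio of a stationary vector of `M` to `w` is
nearly constant. -/
lemma stationary_ratio_sub_le [Nonempty ι] {M P : Matrix ι ι ℝ} {π w : ι → ℝ} {a K g ε H h : ℝ}
    (hrow : ∀ i, ∑ j, M i j = 1) (hπM : Matrix.vecMul π M = π)
    (ha : 0 < a) (hwa : ∀ i, a ≤ w i) (hwK : ∀ i, w i ≤ K * a)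
    (hbal : ∀ i j, w i * P i j = w j * P j i) (hg : 0 < g)
    (hPg : ∀ i j, i ≠ j → g / Fintype.card ι ≤ P i j)
    (hMP : ∀ i j, i ≠ j → |M i j - P i j| ≤ ε / Fintype.card ι) (hε : 0 ≤ ε)
    (hπ : ∀ i, 0 < π i) (i₁ i₀ : ι) (hH : π i₁ = H * w i₁) (hh : π i₀ = h * w i₀)
    (hπH : ∀ i, π i ≤ H * w i) (hπh : ∀ i, h * w i ≤ π i) :
    H - h ≤ 4 * K * ε / g * H := by
  have hcard : (0 : ℝ) < Fintype.card ι := by exact_mod_cast Fintype.card_pos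
  have hw : ∀ i, 0 < w i := fun i => ha.trans_le (hwa i)
  have hHpos : 0 < H := by
    have := hπ i₁
    rw [hH] at this
    exact pos_of_mul_pos_left this (hw i₁).le
  -- By detailed balance the summand is `π j * P j i - π i * P i j`. The same sum with `M` in place
  -- of `P` vanishes by stationarity, so only `M - P` remains. The diagonal term cancels, hence
  -- diagonal entries of `P` are irrelevant.
  have hflow : ∀ j, |∑ i, (π j / w j - π i / w i) * (w i * P i j)| ≤ 2 * H * (K * a) * ε := by
    intro j
    have hj : ∑ i, (π j / w j - π i / w i) * (w i * P i j)
        = ∑ i, (π i * (M i j - P i j) - π j * (M j i - P j i)) := by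
      have hb : ∑ i, π i * M i j = ∑ i, π j * M j i := by
        rw [← Finset.mul_sum, hrow, mul_one]
        exact congrFun hπM j
      have : ∀ i, (π j / w j - π i / w i) * (w i * P i j) = π j * P j i - π i * P i j := by
        intro i
        rw [sub_mul]
        congr 1
        · rw [hbal i j]
          field_simp [(hw j).ne']
        · field_simp [(hw i).ne']
      simp_rw [this, mul_sub, Finset.sum_sub_distrib, hb]
      ring
    rw [hj]
    have hterm : ∀ i ∈ Finset.univ, |π i * (M i j - P i j) - π j * (M j i - P j i)|
        ≤ 2 * H * (K * a) * (ε / Fintype.card ι) := by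
      intro i _
      have hKa : 0 ≤ K * a := (hw j).le.trans (hwK j)
      have hε' : 0 ≤ ε / Fintype.card ι := by positivity
      by_cases hij : i = j
      · subst hij
        rw [sub_self, abs_zero]
        positivity
      · have hb : ∀ k l, k ≠ l → |π k * (M k l - P k l)| ≤ H * (K * a) * (ε / Fintype.card ι) := by
          intro k l hkl
          rw [abs_mul, abs_of_pos (hπ k)]
          refine mul_le_mul ?_ (hMP k l hkl) (abs_nonneg _) (by positivity)
          exact (hπH k).trans (mul_le_mul_of_nonneg_left (hwK k) hHpos.le)
        refine (abs_sub _ _).trans ?_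
        linarith [hb i j hij, hb j i (Ne.symm hij)]
    refine (Finset.abs_sum_le_sum_abs _ _).trans ((Finset.sum_le_sum hterm).trans ?_)
    rw [Finset.sum_const, Finset.card_univ, nsmul_eq_mul]
    field_simp
    exact le_rfl
  have hS : ∀ i j, i ≠ j → a * (g / Fintype.card ι) ≤ w i * P i j := fun i j hij =>
    mul_le_mul (hwa i) (hPg i j hij) (by positivity) (hw i).le
  -- At the maximizer `i₁` all summands of the flow are nonnegative, so each weight `w i * P i j`
  -- may be lowered to `a * (g / |ι|)`. The minimizer `i₀` is treated symmetrically in `h2`.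
  have h1 : ∑ i, (H - π i / w i) * (a * (g / Fintype.card ι)) ≤ 2 * H * (K * a) * ε := by
    refine le_trans (Finset.sum_le_sum fun i _ => ?_) ((le_abs_self _).trans (hflow i₁))
    rw [hH, mul_div_assoc, div_self (hw i₁).ne', mul_one]
    by_cases hi : i = i₁
    · subst hi
      rw [hH, mul_div_assoc, div_self (hw i).ne', mul_one, sub_self, zero_mul, zero_mul]
    · exact mul_le_mul_of_nonneg_left (hS i i₁ hi)
        (sub_nonneg.2 ((div_le_iff₀ (hw i)).2 (hπH i)))
  have h2 : ∑ i, (π i / w i - h) * (a * (g / Fintype.card ι)) ≤ 2 * H * (K * a) * ε := by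
    refine le_trans ?_ ((neg_le_abs _).trans (hflow i₀))
    rw [← Finset.sum_neg_distrib]
    refine Finset.sum_le_sum fun i _ => ?_
    rw [hh, mul_div_assoc, div_self (hw i₀).ne', mul_one, ← neg_mul, neg_sub]
    by_cases hi : i = i₀
    · subst hi
      rw [hh, mul_div_assoc, div_self (hw i).ne', mul_one, sub_self, zero_mul, zero_mul]
    · exact mul_le_mul_of_nonneg_left (hS i i₀ hi)
        (sub_nonneg.2 ((le_div_iff₀ (hw i)).2 (hπh i)))
  -- The intermediate ratios cancel, leaving `|ι|` copies of `H - h`.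
  have h3 : ∑ i, (H - π i / w i) * (a * (g / Fintype.card ι))
      + ∑ i, (π i / w i - h) * (a * (g / Fintype.card ι)) = (H - h) * g * a := by
    rw [← Finset.sum_add_distrib]
    simp_rw [← add_mul, sub_add_sub_cancel]
    rw [Finset.sum_const, Finset.card_univ, nsmul_eq_mul]
    field_simp
  have h4 : (H - h) * g * a ≤ 4 * K * ε * H * a := by linarith
  rw [div_mul_eq_mul_div, le_div_iff₀ hg]
  exact le_of_mul_le_mul_right h4 ha

variable [DecidableEq ι]

/-- A left fixed vector of an entrywise positive stochastic matrix has constant sign. -/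
lemma nonneg_or_neg_of_vecMul_eq_self {M : Matrix ι ι ℝ} (hM : M ∈ Matrix.rowStochastic ℝ ι)
    (hpos : ∀ i j, 0 < M i j) {v : ι → ℝ} (hv : Matrix.vecMul v M = v) :
    (∀ i, 0 ≤ v i) ∨ ∀ i, v i < 0 := by
  -- The triangle inequality gives `|v| ≤ |v| M`. Both sides have the same total because rows sum to
  -- one, so equality holds and `|v|` is fixed.
  have hle : ∀ j, |v j| ≤ Matrix.vecMul (fun i => |v i|) M j := by
    intro j
    conv_lhs => rw [← hv]
    refine (Finset.abs_sum_le_sum_abs _ _).trans (Finset.sum_le_sum fun i _ => ?_)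
    rw [abs_mul, abs_of_pos (hpos i j)]
  have hsum : ∑ j, Matrix.vecMul (fun i => |v i|) M j = ∑ j, |v j| := by
    simp only [Matrix.vecMul, dotProduct]
    rw [Finset.sum_comm]
    simp_rw [← Finset.mul_sum, Matrix.sum_row_of_mem_rowStochastic hM, mul_one]
  have heq : Matrix.vecMul (fun i => |v i|) M = fun i => |v i| := by
    funext j
    exact (((Finset.sum_eq_sum_iff_of_le fun j _ => hle j).1 hsum.symm) j (Finset.mem_univ j)).symm
  -- `|v| - v` is a nonnegative fixed vector, so it is either zero or positive everywhere.
  have hw : Matrix.vecMul ((fun i => |v i|) - v) M = (fun i => |v i|) - v := by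
    rw [Matrix.sub_vecMul, heq, hv]
  by_cases h0 : (fun i => |v i|) - v = 0
  · left
    intro i
    have := congrFun h0 i
    simp only [Pi.sub_apply, Pi.zero_apply] at this
    rw [← sub_eq_zero.1 this]
    exact abs_nonneg _
  · right
    intro i
    have := pos_of_vecMul_eq_self hpos hw (fun i => sub_nonneg.2 (le_abs_self _)) h0 i
    simp only [Pi.sub_apply] at this
    by_contra hcon
    rw [abs_of_nonneg (not_lt.1 hcon)] at this
    linarith

/-- An entrywise positive stochastic matrix has a unique stationary distribution, which is
positive. -/
lemma exists_unique_stationary {m : ℕ} [NeZero m] {M : Matrix (Fin m) (Fin m) ℝ}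
    (hM : M ∈ Matrix.rowStochastic ℝ (Fin m)) (hpos : ∀ i j, 0 < M i j) :
    ∃ π : Fin m → ℝ, IsStationaryDistribution M π ∧
      (∀ π', IsStationaryDistribution M π' → π' = π) ∧ ∀ i, 0 < π i := by
  -- The constant vector is a right null vector of `M - 1`, so a left null vector exists too.
  have hdet : (M - 1).det = 0 := by
    refine Matrix.exists_mulVec_eq_zero_iff.1 ⟨1, one_ne_zero, ?_⟩
    rw [Matrix.sub_mulVec, Matrix.one_vecMul_of_mem_rowStochastic hM, Matrix.one_mulVec, sub_self]
  obtain ⟨v, hv0, hv⟩ := Matrix.exists_vecMul_eq_zero_iff.2 hdet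
  rw [Matrix.vecMul_sub, Matrix.vecMul_one, sub_eq_zero] at hv
  obtain ⟨u, hu, hupos⟩ : ∃ u : Fin m → ℝ, Matrix.vecMul u M = u ∧ ∀ i, 0 < u i := by
    rcases nonneg_or_neg_of_vecMul_eq_self hM hpos hv with h | h
    · exact ⟨v, hv, pos_of_vecMul_eq_self hpos hv h hv0⟩
    · exact ⟨-v, by rw [Matrix.neg_vecMul, hv], fun i => neg_pos.2 (h i)⟩
  have hs : 0 < ∑ i, u i := Finset.sum_pos (fun i _ => hupos i) Finset.univ_nonempty
  refine ⟨(∑ i, u i)⁻¹ • u, ⟨⟨fun i => ?_, ?_⟩, ?_⟩, ?_, fun i => ?_⟩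
  · exact (mul_pos (inv_pos.2 hs) (hupos i)).le
  · simp only [Pi.smul_apply, smul_eq_mul, ← Finset.mul_sum]
    exact inv_mul_cancel₀ hs.ne'
  · rw [Matrix.smul_vecMul, hu]
  · rintro π' ⟨⟨-, h1⟩, h2⟩
    -- The difference of two stationary distributions is fixed and sums to zero; having constant
    -- sign, it vanishes.
    have hd : Matrix.vecMul (π' - (∑ i, u i)⁻¹ • u) M = π' - (∑ i, u i)⁻¹ • u := by
      rw [Matrix.sub_vecMul, h2, Matrix.smul_vecMul, hu]
    have hd1 : ∑ i, (π' - (∑ i, u i)⁻¹ • u) i = 0 := by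
      simp only [Pi.sub_apply, Pi.smul_apply, smul_eq_mul, Finset.sum_sub_distrib,
        ← Finset.mul_sum, h1]
      rw [inv_mul_cancel₀ hs.ne', sub_self]
    rcases nonneg_or_neg_of_vecMul_eq_self hM hpos hd with h | h
    · have := (Finset.sum_eq_zero_iff_of_nonneg fun i _ => h i).1 hd1
      exact sub_eq_zero.1 (funext fun i => this i (Finset.mem_univ i))
    · exact absurd hd1 (Finset.sum_neg (fun i _ => h i) Finset.univ_nonempty).ne
  · exact mul_pos (inv_pos.2 hs) (hupos i)

end Stochastic

/-! ### Concentration of sums of independent indicators. -/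

section Chernoff

variable {Ω : Type*} [MeasurableSpace Ω] {μ : Measure Ω}

/-- Events determined by disjoint blocks of an independent family are independent. -/
lemma iIndepFun.iIndepSet_iInter {ι κ : Type*} [Fintype κ] {β : Type*}
    [MeasurableSpace β] {f : ι × κ → Ω → β} (hf : iIndepFun f μ) (hm : ∀ e, Measurable (f e))
    {s : ι × κ → Set β} (hs : ∀ e, MeasurableSet (s e)) :
    iIndepSet (fun i => ⋂ k, f (i, k) ⁻¹' s (i, k)) μ := by
  classical
  have hmul := iIndepFun_iff_measure_inter_preimage_eq_mul.1 hf
  rw [iIndepSet_iff_meas_biInter fun i => MeasurableSet.iInter fun k => hm _ (hs _)]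
  have hone : ∀ i, μ (⋂ k, f (i, k) ⁻¹' s (i, k)) = ∏ k, μ (f (i, k) ⁻¹' s (i, k)) := by
    intro i
    have := hmul ({i} ×ˢ Finset.univ) (sets := s) fun e _ => hs e
    rw [Finset.prod_product, Finset.prod_singleton] at this
    rw [← this]
    congr 1
    ext ω
    simp
  intro S
  simp_rw [hone]
  rw [← Finset.prod_product', ← hmul (S ×ˢ Finset.univ) (sets := s) fun e _ => hs e]
  congr 1
  ext ω
  simp only [Set.mem_iInter, Finset.mem_product, Finset.mem_univ, and_true, Prod.forall]
  exact ⟨fun h a b ha => h a ha b, fun h a ha b => h a b ha⟩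

variable [IsProbabilityMeasure μ]

/-- The moment generating function is `1 + (exp t - 1) * μ.real E`, and `exp t - 1 ≤ t + t ^ 2` for
`|t| ≤ 1`. -/
lemma mgf_indicator_one_le {E : Set Ω} (hE : MeasurableSet E) {t : ℝ} (ht : |t| ≤ 1) :
    mgf (E.indicator fun _ => (1 : ℝ)) μ t ≤ Real.exp (μ.real E * (t + t ^ 2)) := by
  have h1 : (fun ω => Real.exp (t * E.indicator (fun _ => (1 : ℝ)) ω))
      = fun ω => 1 + (Real.exp t - 1) * E.indicator (fun _ => (1 : ℝ)) ω := by
    funext ω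
    by_cases h : ω ∈ E <;> simp [h]
  have h2 : mgf (E.indicator fun _ => (1 : ℝ)) μ t = 1 + (Real.exp t - 1) * μ.real E := by
    rw [mgf, h1, integral_add (integrable_const _)
      (((integrable_const _).indicator hE).const_mul _), integral_const_mul,
      integral_indicator_const _ hE]
    simp
  rw [h2]
  refine le_trans ?_ (Real.add_one_le_exp _)
  have h3 := (abs_le.1 (Real.abs_exp_sub_one_sub_id_le ht)).2
  nlinarith [measureReal_nonneg (μ := μ) (s := E)]

lemma mgf_sum_indicator_le {ι : Type*} [Fintype ι] {E : ι → Set Ω} (hE : ∀ i, MeasurableSet (E i))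
    (hind : iIndepSet E μ) {t : ℝ} (ht : |t| ≤ 1) :
    mgf (∑ i, (E i).indicator fun _ => (1 : ℝ)) μ t
      ≤ Real.exp ((∑ i, μ.real (E i)) * (t + t ^ 2)) := by
  rw [hind.iIndepFun_indicator.mgf_sum fun i => measurable_const.indicator (hE i), Finset.sum_mul,
    Real.exp_sum]
  exact Finset.prod_le_prod (fun i _ => mgf_nonneg) fun i _ => mgf_indicator_one_le (hE i) ht

/-- Chernoff's bound for the number of independent events that occur. -/
lemma measureReal_abs_sum_indicator_sub_le {ι : Type*} [Fintype ι] {E : ι → Set Ω}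
    (hE : ∀ i, MeasurableSet (E i)) (hind : iIndepSet E μ) {N t : ℝ}
    (hN : ∑ i, μ.real (E i) ≤ N) (ht0 : 0 ≤ t) (ht1 : t ≤ 1) :
    μ.real {ω | 2 * t * N ≤ |∑ i, (E i).indicator (fun _ => (1 : ℝ)) ω - ∑ i, μ.real (E i)|}
      ≤ 2 * Real.exp (-(t ^ 2 * N)) := by
  set S : Ω → ℝ := ∑ i, (E i).indicator fun _ => (1 : ℝ) with hS
  set q := ∑ i, μ.real (E i) with hq
  have hSm : Measurable S := by
    have : S = fun ω => ∑ i, (E i).indicator (fun _ => (1 : ℝ)) ω := by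
      funext ω
      rw [hS, Finset.sum_apply]
    rw [this]
    exact Finset.measurable_sum _ fun i _ => measurable_const.indicator (hE i)
  have hSbound : ∀ ω, |S ω| ≤ Fintype.card ι := by
    intro ω
    rw [hS, Finset.sum_apply]
    refine (Finset.abs_sum_le_sum_abs _ _).trans ?_
    refine (Finset.sum_le_card_nsmul _ _ 1 fun i _ => ?_).trans (by simp)
    by_cases h : ω ∈ E i <;> simp [h]
  have hint : ∀ r : ℝ, Integrable (fun ω => Real.exp (r * S ω)) μ := by
    intro r
    refine Integrable.of_bound (C := Real.exp (|r| * Fintype.card ι))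
      (by fun_prop) (Filter.Eventually.of_forall fun ω => ?_)
    rw [Real.norm_eq_abs, Real.abs_exp, Real.exp_le_exp]
    refine (le_abs_self _).trans ?_
    rw [abs_mul]
    exact mul_le_mul_of_nonneg_left (hSbound ω) (abs_nonneg _)
  -- Markov's inequality with exponent `t` itself leaves `q * t ^ 2 - 2 * t ^ 2 * N`, and `q ≤ N`.
  -- The lower tail uses `-t`.
  have hup : μ.real {ω | q + 2 * t * N ≤ S ω} ≤ Real.exp (-(t ^ 2 * N)) := by
    refine (measure_ge_le_exp_mul_mgf _ ht0 (hint t)).trans ?_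
    refine (mul_le_mul_of_nonneg_left (mgf_sum_indicator_le hE hind (abs_le.2 ⟨by linarith, ht1⟩))
      (Real.exp_pos _).le).trans ?_
    rw [← Real.exp_add, Real.exp_le_exp]
    nlinarith [mul_le_mul_of_nonneg_left hN (sq_nonneg t)]
  have hlow : μ.real {ω | S ω ≤ q - 2 * t * N} ≤ Real.exp (-(t ^ 2 * N)) := by
    refine (measure_le_le_exp_mul_mgf _ (neg_nonpos.2 ht0) (hint (-t))).trans ?_
    refine (mul_le_mul_of_nonneg_left (mgf_sum_indicator_le hE hind
      (by rw [abs_neg]; exact abs_le.2 ⟨by linarith, ht1⟩)) (Real.exp_pos _).le).trans ?_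
    rw [← Real.exp_add, Real.exp_le_exp]
    nlinarith [mul_le_mul_of_nonneg_left hN (sq_nonneg t)]
  have hsub : {ω | 2 * t * N ≤ |∑ i, (E i).indicator (fun _ => (1 : ℝ)) ω - q|}
      ⊆ {ω | q + 2 * t * N ≤ S ω} ∪ {ω | S ω ≤ q - 2 * t * N} := by
    intro ω hω
    have hSω : ∑ i, (E i).indicator (fun _ => (1 : ℝ)) ω = S ω := by rw [hS, Finset.sum_apply]
    rw [Set.mem_ofPred_eq, hSω] at hω
    rcases le_abs'.1 hω with h | h
    · right
      change S ω ≤ q - 2 * t * N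
      linarith
    · left
      change q + 2 * t * N ≤ S ω
      linarith
  refine (measureReal_mono hsub).trans ((measureReal_union_le _ _).trans ?_)
  linarith

end Chernoff

/-! ### Discordant responses: independence, probabilities, reversibility. -/

section Rasch

variable {Ω : Type*} {n m : ℕ} {p : ℝ}
  {θ : Fin n → ℝ} {βs : Fin m → ℝ} {A X : Fin n → Fin m → Ω → Bool}

/-- User `l` is assigned both `i` and `j`, responds `1` to `i` and `0` to `j`. -/
def discordantEvent (A X : Fin n → Fin m → Ω → Bool) (i j : Fin m) (l : Fin n) : Set Ω :=
  {ω | A l i ω = true ∧ A l j ω = true ∧ X l i ω = true ∧ X l j ω = false}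

/-- The probability that a user with parameter `t` responds `1` to an item with parameter `b` and
`0` to an item with parameter `c`. -/
noncomputable def discordance (t b c : ℝ) : ℝ :=
  Real.exp t / (Real.exp t + Real.exp b) * (Real.exp c / (Real.exp t + Real.exp c))

/-- Both sides have numerator `exp (t + b + c)` over the same denominator. As the weights do not
depend on the user `t`, detailed balance survives summation over users. -/
lemma exp_mul_discordance_comm (t b c : ℝ) :
    Real.exp b * discordance t b c = Real.exp c * discordance t c b := by
  unfold discordance
  ring

lemma discordance_pos (t b c : ℝ) : 0 < discordance t b c := by
  unfold discordance
  positivity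

lemma discordance_le_one (t b c : ℝ) : discordance t b c ≤ 1 := by
  unfold discordance
  refine mul_le_one₀ ?_ (by positivity) ?_
  · rw [div_le_one (by positivity)]
    linarith [Real.exp_pos b]
  · rw [div_le_one (by positivity)]
    linarith [Real.exp_pos t]

lemma sum_indicator_discordantEvent (i j : Fin m) (ω : Ω) :
    ∑ l, (discordantEvent A X i j l).indicator (fun _ => (1 : ℝ)) ω
      = ∑ l, bit (A l i ω) * bit (A l j ω) * (bit (X l i ω) * (1 - bit (X l j ω))) := by
  refine Finset.sum_congr rfl fun l _ => ?_
  unfold discordantEvent bit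
  rw [Set.indicator_apply]
  by_cases h₁ : A l i ω = true <;> by_cases h₂ : A l j ω = true <;>
    by_cases h₃ : X l i ω = true <;> by_cases h₄ : X l j ω = true <;> simp [h₁, h₂, h₃, h₄]

lemma discordantEvent_eq_iInter (i j : Fin m) (l : Fin n) :
    discordantEvent A X i j l = ⋂ k : Fin 4,
      (![A l i, A l j, X l i, X l j] : Fin 4 → Ω → Bool) k ⁻¹'
        {(![true, true, true, false] : Fin 4 → Bool) k} := by
  ext ω
  simp [discordantEvent, Fin.forall_fin_succ]

variable [MeasurableSpace Ω] {μ : Measure Ω}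

namespace IsRaschModel

lemma prob_response_false [IsProbabilityMeasure μ]
    (h : IsRaschModel μ p θ βs A X) (l : Fin n) (j : Fin m) :
    μ.real {ω | X l j ω = false} = Real.exp (βs j) / (Real.exp (θ l) + Real.exp (βs j)) := by
  have hc : {ω | X l j ω = false} = {ω | X l j ω = true}ᶜ := by
    ext ω
    simp
  have hm : MeasurableSet {ω | X l j ω = true} :=
    h.measurable_response l j (measurableSet_singleton true)
  rw [hc, probReal_compl_eq_one_sub hm, h.prob_response]
  field_simp
  ring

lemma measurableSet_discordantEvent (h : IsRaschModel μ p θ βs A X) (i j : Fin m) (l : Fin n) :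
    MeasurableSet (discordantEvent A X i j l) :=
  (h.measurable_assignment l i (measurableSet_singleton true)).inter
    ((h.measurable_assignment l j (measurableSet_singleton true)).inter
      ((h.measurable_response l i (measurableSet_singleton true)).inter
        (h.measurable_response l j (measurableSet_singleton false))))

lemma integral_discordance [IsProbabilityMeasure μ]
    (h : IsRaschModel μ p θ βs A X) {i j : Fin m} (hij : i ≠ j) (l : Fin n) :
    ∫ ω, bit (X l i ω) * (1 - bit (X l j ω)) ∂μ = discordance (θ l) (βs i) (βs j) := by
  have hf : (fun ω => bit (X l i ω) * (1 - bit (X l j ω)))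
      = ({ω | X l i ω = true} ∩ {ω | X l j ω = false}).indicator fun _ => 1 := by
    funext ω
    unfold bit
    rw [Set.indicator_apply]
    by_cases hi : X l i ω = true <;> by_cases hj : X l j ω = true <;> simp [hi, hj]
  have hmi : MeasurableSet {ω | X l i ω = true} :=
    h.measurable_response l i (measurableSet_singleton true)
  have hmj : MeasurableSet {ω | X l j ω = false} :=
    h.measurable_response l j (measurableSet_singleton false)
  have hne : (Sum.inr (l, i) : (Fin n × Fin m) ⊕ (Fin n × Fin m)) ≠ Sum.inr (l, j) := by
    simpa using hij
  have hind : IndepFun (X l i) (X l j) μ := h.indep.indepFun hne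
  have := hind.measure_inter_preimage_eq_mul {true} {false} (measurableSet_singleton _)
    (measurableSet_singleton _)
  rw [hf, integral_indicator_const _ (hmi.inter hmj), smul_eq_mul, mul_one, measureReal_def]
  change μ ({ω | X l i ω = true} ∩ {ω | X l j ω = false})
    = μ {ω | X l i ω = true} * μ {ω | X l j ω = false} at this
  rw [this, ENNReal.toReal_mul, ← measureReal_def, ← measureReal_def, h.prob_response,
    h.prob_response_false, discordance]

/-- The four responses that decide `discordantEvent`, as one independent family. -/
lemma indep_blocks (h : IsRaschModel μ p θ βs A X) {i j : Fin m} (hij : i ≠ j) :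
    iIndepFun (fun e : Fin n × Fin 4 =>
      (![A e.1 i, A e.1 j, X e.1 i, X e.1 j] : Fin 4 → Ω → Bool) e.2) μ := by
  let g : Fin n × Fin 4 → (Fin n × Fin m) ⊕ (Fin n × Fin m) := fun e =>
    (![Sum.inl (e.1, i), Sum.inl (e.1, j), Sum.inr (e.1, i), Sum.inr (e.1, j)] :
      Fin 4 → (Fin n × Fin m) ⊕ (Fin n × Fin m)) e.2
  -- The four coordinates of a block are distinct only because `i ≠ j`.
  have hg : Function.Injective g := by
    rintro ⟨l, k⟩ ⟨l', k'⟩ he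
    have hji := hij.symm
    fin_cases k <;> fin_cases k' <;> simp_all [g]
  convert h.indep.precomp hg using 1
  funext ⟨l, k⟩
  fin_cases k <;> rfl

lemma iIndepSet_discordantEvent (h : IsRaschModel μ p θ βs A X) {i j : Fin m} (hij : i ≠ j) :
    iIndepSet (discordantEvent A X i j) μ := by
  have hm : ∀ e : Fin n × Fin 4,
      Measurable ((![A e.1 i, A e.1 j, X e.1 i, X e.1 j] : Fin 4 → Ω → Bool) e.2) := by
    rintro ⟨l, k⟩
    fin_cases k
    exacts [h.measurable_assignment l i, h.measurable_assignment l j, h.measurable_response l i,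
      h.measurable_response l j]
  have := iIndepFun.iIndepSet_iInter (h.indep_blocks hij) hm
    (s := fun e => {(![true, true, true, false] : Fin 4 → Bool) e.2})
    fun e => measurableSet_singleton _
  convert this using 1
  funext l
  exact discordantEvent_eq_iInter i j l

lemma measureReal_discordantEvent [IsProbabilityMeasure μ]
    (h : IsRaschModel μ p θ βs A X) {i j : Fin m} (hij : i ≠ j)
    (l : Fin n) :
    μ.real (discordantEvent A X i j l) = p ^ 2 * discordance (θ l) (βs i) (βs j) := by
  have hmul := iIndepFun_iff_measure_inter_preimage_eq_mul.1 (h.indep_blocks hij)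
    ({l} ×ˢ Finset.univ) (sets := fun e => {(![true, true, true, false] : Fin 4 → Bool) e.2})
    fun e _ => measurableSet_singleton _
  rw [Finset.prod_product, Finset.prod_singleton, Fin.prod_univ_four] at hmul
  have hE : discordantEvent A X i j l = ⋂ e ∈ ({l} ×ˢ Finset.univ : Finset (Fin n × Fin 4)),
      (![A e.1 i, A e.1 j, X e.1 i, X e.1 j] : Fin 4 → Ω → Bool) e.2 ⁻¹'
        {(![true, true, true, false] : Fin 4 → Bool) e.2} := by
    rw [discordantEvent_eq_iInter]
    ext ω
    simp
  rw [measureReal_def, hE, hmul]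
  simp only [ENNReal.toReal_mul]
  change μ.real {ω | A l i ω = true} * μ.real {ω | A l j ω = true} *
    μ.real {ω | X l i ω = true} * μ.real {ω | X l j ω = false} = _
  rw [h.prob_assignment, h.prob_assignment, h.prob_response, h.prob_response_false, discordance]
  ring

end IsRaschModel

end Rasch

/-! ### From closeness of counts to the error of the estimate. -/

section SpectralEstimate

lemma abs_sub_mean_le {m : ℕ} [NeZero m] {r : Fin m → ℝ} {lo hi : ℝ} (hlo : ∀ i, lo ≤ r i)
    (hhi : ∀ i, r i ≤ hi) (i : Fin m) : |r i - (1 / (m : ℝ)) * ∑ k, r k| ≤ hi - lo := by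
  have hm : (0 : ℝ) < m := by exact_mod_cast Nat.pos_of_ne_zero (NeZero.ne m)
  have h1 : m * lo ≤ ∑ k, r k := by
    simpa using Finset.card_nsmul_le_sum Finset.univ r lo fun k _ => hlo k
  have h2 : ∑ k, r k ≤ m * hi := by
    simpa using Finset.sum_le_card_nsmul Finset.univ r hi fun k _ => hhi k
  have h1' : lo ≤ (1 / (m : ℝ)) * ∑ k, r k := by
    rw [one_div, ← div_eq_inv_mul, le_div_iff₀ hm]
    linarith
  have h2' : (1 / (m : ℝ)) * ∑ k, r k ≤ hi := by
    rw [one_div, ← div_eq_inv_mul, div_le_iff₀ hm]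
    linarith
  exact abs_le.2 ⟨by linarith [hlo i], by linarith [hhi i]⟩

/-- `log (H / h) ≤ (H - h) / h`, and `h ≥ H / 2` because `δ ≤ 1 / 2`. -/
lemma log_sub_log_le_of_sub_le {H h δ : ℝ} (hh : 0 < h) (hhH : h ≤ H) (hδ : δ ≤ 1 / 2)
    (hsub : H - h ≤ δ * H) : Real.log H - Real.log h ≤ 2 * δ := by
  have hH : 0 < H := hh.trans_le hhH
  rw [← Real.log_div hH.ne' hh.ne']
  refine (Real.log_le_sub_one_of_pos (div_pos hH hh)).trans ?_
  rw [sub_le_iff_le_add, div_le_iff₀ hh]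
  nlinarith

/-- A stochastic matrix that is close off the diagonal to a matrix in detailed balance with
`exp ∘ βs` has a well-defined spectral estimate, which is close to `βs`. -/
lemma exists_isSpectralEstimate {m : ℕ} [NeZero m] {M P : Matrix (Fin m) (Fin m) ℝ}
    {βs : Fin m → ℝ} {κ g ε : ℝ} (hM : M ∈ Matrix.rowStochastic ℝ (Fin m))
    (hpos : ∀ i j, 0 < M i j) (hβ : ∑ i, βs i = 0) (hκ : ∀ i j, |βs i - βs j| ≤ κ)
    (hbal : ∀ i j, Real.exp (βs i) * P i j = Real.exp (βs j) * P j i) (hg : 0 < g)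
    (hPg : ∀ i j, i ≠ j → g / m ≤ P i j) (hMP : ∀ i j, i ≠ j → |M i j - P i j| ≤ ε / m)
    (hε : 0 ≤ ε) (hsmall : 4 * Real.exp κ * ε / g ≤ 1 / 2) :
    ∃ b : Fin m → ℝ, IsSpectralEstimate M b ∧ ‖b - βs‖ ≤ 2 * (4 * Real.exp κ * ε / g) := by
  obtain ⟨π, hst, huniq, hπ⟩ := exists_unique_stationary hM hpos
  refine ⟨fun i => Real.log (π i) - (1 / (m : ℝ)) * ∑ k, Real.log (π k),
    ⟨hM, π, hst, huniq, hπ, fun i => rfl⟩, ?_⟩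
  set w : Fin m → ℝ := fun i => Real.exp (βs i) with hw
  have hwpos : ∀ i, 0 < w i := fun i => Real.exp_pos _
  obtain ⟨i₁, hi₁⟩ := Finite.exists_max fun i => π i / w i
  obtain ⟨i₀, hi₀⟩ := Finite.exists_min fun i => π i / w i
  obtain ⟨k, hk⟩ := Finite.exists_min w
  have hwK : ∀ i, w i ≤ Real.exp κ * w k := by
    intro i
    rw [hw]
    dsimp only
    rw [← Real.exp_add, Real.exp_le_exp]
    linarith [(le_abs_self _).trans (hκ i k)]
  have hsub := stationary_ratio_sub_le (M := M) (P := P) (π := π) (w := w)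
    (H := π i₁ / w i₁) (h := π i₀ / w i₀)
    (fun i => Matrix.sum_row_of_mem_rowStochastic hM i) hst.2 (hwpos k) hk hwK hbal hg
    (by simpa using hPg) (by simpa using hMP) hε hπ i₁ i₀
    (div_mul_cancel₀ _ (hwpos i₁).ne').symm (div_mul_cancel₀ _ (hwpos i₀).ne').symm
    (fun i => (div_le_iff₀ (hwpos i)).1 (hi₁ i)) (fun i => (le_div_iff₀ (hwpos i)).1 (hi₀ i))
  have hratio : ∀ i, 0 < π i / w i := fun i => div_pos (hπ i) (hwpos i)
  have hlog := log_sub_log_le_of_sub_le (hratio i₀) (hi₀ i₁) hsmall hsub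
  have hr : ∀ i, Real.log (π i / w i) = Real.log (π i) - βs i := by
    intro i
    rw [Real.log_div (hπ i).ne' (hwpos i).ne', hw, Real.log_exp]
  refine (pi_norm_le_iff_of_nonneg (by positivity)).2 fun i => ?_
  have hmean := abs_sub_mean_le (r := fun i => Real.log (π i / w i))
    (fun i => Real.log_le_log (hratio i₀) (hi₀ i)) (fun i => Real.log_le_log (hratio i) (hi₁ i)) i
  -- Since `βs` sums to zero, centering `log (π i) - βs i` yields exactly the estimate minus `βs i`.
  simp only [hr, Finset.sum_sub_distrib, hβ, sub_zero] at hmean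
  rw [hr, hr] at hlog
  refine le_trans (le_of_eq ?_) (hmean.trans hlog)
  rw [Pi.sub_apply, Real.norm_eq_abs]
  congr 1
  ring

lemma spectralMatrix_apply_of_ne {n m : ℕ} {d : ℝ} {a x : Fin n → Fin m → Bool} {i j : Fin m}
    (hij : i ≠ j) : spectralMatrix d a x i j =
      (1 / d) * ∑ l : Fin n, bit (a l i) * bit (a l j) * (bit (x l i) * (1 - bit (x l j))) := by
  simp [spectralMatrix, hij]

lemma sum_spectralMatrix {n m : ℕ} (d : ℝ) (a x : Fin n → Fin m → Bool) (i : Fin m) :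
    ∑ j, spectralMatrix d a x i j = 1 := by
  rw [← Finset.add_sum_erase _ _ (Finset.mem_univ i)]
  have : ∀ j ∈ Finset.univ.erase i, spectralMatrix d a x i j =
      (1 / d) * ∑ l : Fin n, bit (a l i) * bit (a l j) * (bit (x l i) * (1 - bit (x l j))) :=
    fun j hj => spectralMatrix_apply_of_ne (Finset.ne_of_mem_erase hj).symm
  rw [Finset.sum_congr rfl this]
  simp [spectralMatrix]

/-- If all pairwise comparison counts are within `2 * t * N` of their means, then the spectral
estimate is well defined and has error at most `16 * exp κ * t / γ`. -/
lemma exists_isSpectralEstimate_of_counts {n m : ℕ} [NeZero m] {p t γ κ N : ℝ} {θ : Fin n → ℝ}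
    {βs : Fin m → ℝ} {a x : Fin n → Fin m → Bool} (hβ : ∑ i, βs i = 0)
    (hκ : ∀ i j, |βs i - βs j| ≤ κ) (hN : N = n * p ^ 2) (hNpos : 0 < N) (hγ : 0 < γ)
    (hγ1 : γ ≤ 1) (hγle : ∀ l i j, i ≠ j → γ ≤ discordance (θ l) (βs i) (βs j)) (ht : 0 ≤ t)
    (hsmall : 16 * Real.exp κ * t ≤ γ)
    (hclose : ∀ i j, i ≠ j →
      |∑ l, bit (a l i) * bit (a l j) * (bit (x l i) * (1 - bit (x l j)))
        - ∑ l, p ^ 2 * discordance (θ l) (βs i) (βs j)| ≤ 2 * t * N) :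
    ∃ b : Fin m → ℝ, IsSpectralEstimate (spectralMatrix (3 * m * n * p ^ 2 / 2) a x) b ∧
      ‖b - βs‖ ≤ 16 * Real.exp κ * t / γ := by
  have hm : (0 : ℝ) < m := by exact_mod_cast Nat.pos_of_ne_zero (NeZero.ne m)
  have hκ0 : 0 ≤ κ := (abs_nonneg _).trans (hκ 0 0)
  have hK : 1 ≤ Real.exp κ := Real.one_le_exp hκ0
  have hd : (3 * m * n * p ^ 2 / 2 : ℝ) = 3 / 2 * m * N := by
    rw [hN]
    ring
  rw [hd]
  set d : ℝ := 3 / 2 * m * N with hd_def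
  have hdpos : 0 < d := by positivity
  set M := spectralMatrix d a x with hMdef
  -- Off the diagonal this is the mean of `M`. The diagonal is whatever the formula gives; `P` need
  -- not be stochastic.
  let P : Matrix (Fin m) (Fin m) ℝ := Matrix.of fun i j =>
    (1 / d) * ∑ l, p ^ 2 * discordance (θ l) (βs i) (βs j)
  have hP : ∀ i j, P i j = (1 / d) * ∑ l, p ^ 2 * discordance (θ l) (βs i) (βs j) :=
    fun i j => rfl
  have hbal : ∀ i j, Real.exp (βs i) * P i j = Real.exp (βs j) * P j i := by
    intro i j
    have hterm : Real.exp (βs i) * ∑ l, p ^ 2 * discordance (θ l) (βs i) (βs j)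
        = Real.exp (βs j) * ∑ l, p ^ 2 * discordance (θ l) (βs j) (βs i) := by
      rw [Finset.mul_sum, Finset.mul_sum]
      refine Finset.sum_congr rfl fun l _ => ?_
      rw [mul_left_comm, exp_mul_discordance_comm, mul_left_comm]
    rw [hP, hP, mul_left_comm, hterm, mul_left_comm]
  have hPg : ∀ i j, i ≠ j → 2 / 3 * γ / m ≤ P i j := by
    intro i j hij
    have : N * γ ≤ ∑ l, p ^ 2 * discordance (θ l) (βs i) (βs j) := by
      have := Finset.card_nsmul_le_sum Finset.univ
        (fun l => p ^ 2 * discordance (θ l) (βs i) (βs j)) (p ^ 2 * γ)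
        fun l _ => mul_le_mul_of_nonneg_left (hγle l i j hij) (sq_nonneg p)
      rw [Finset.card_univ, Fintype.card_fin, nsmul_eq_mul] at this
      rw [hN]
      linarith
    rw [hP]
    refine le_trans (le_of_eq ?_) (mul_le_mul_of_nonneg_left this (by positivity))
    rw [hd_def]
    field_simp
  have hPle : ∀ i j, P i j ≤ 2 / 3 / m := by
    intro i j
    have : ∑ l, p ^ 2 * discordance (θ l) (βs i) (βs j) ≤ N := by
      have := Finset.sum_le_card_nsmul Finset.univ
        (fun l => p ^ 2 * discordance (θ l) (βs i) (βs j)) (p ^ 2)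
        fun l _ => mul_le_of_le_one_right (sq_nonneg p) (discordance_le_one _ _ _)
      rw [Finset.card_univ, Fintype.card_fin, nsmul_eq_mul] at this
      rwa [hN]
    rw [hP]
    refine le_trans (mul_le_mul_of_nonneg_left this (by positivity)) (le_of_eq ?_)
    rw [hd_def]
    field_simp
  have hMP : ∀ i j, i ≠ j → |M i j - P i j| ≤ 4 / 3 * t / m := by
    intro i j hij
    rw [hMdef, spectralMatrix_apply_of_ne hij, hP, ← mul_sub, abs_mul,
      abs_of_pos (by positivity : 0 < 1 / d)]
    refine le_trans (mul_le_mul_of_nonneg_left (hclose i j hij) (by positivity)) (le_of_eq ?_)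
    rw [hd_def]
    field_simp
    ring
  -- Together with `γ ≤ 1` this makes `4t/3` smaller than `2γ/3` (positivity) and at most `1/3`
  -- (entries at most `1/m`).
  have ht16 : 16 * t ≤ γ := by nlinarith
  have hoffpos : ∀ i j, i ≠ j → 0 < M i j := by
    intro i j hij
    have h1 := hPg i j hij
    have h2 := (abs_le.1 (hMP i j hij)).1
    have h3 : 0 < (2 / 3 * γ - 4 / 3 * t) / m := div_pos (by linarith) hm
    rw [sub_div] at h3
    linarith
  have hoffle : ∀ i j, i ≠ j → M i j ≤ 1 / m := by
    intro i j hij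
    have h1 := hPle i j
    have h2 := (abs_le.1 (hMP i j hij)).2
    have h3 : (2 / 3 + 4 / 3 * t) / m ≤ 1 / m := div_le_div_of_nonneg_right (by linarith) hm.le
    rw [add_div] at h3
    linarith
  -- The `m - 1` off-diagonal entries total at most `(m - 1)/m`. The factor `3/2` in `d` provides
  -- the room.
  have hdiag : ∀ i, 0 < M i i := by
    intro i
    have hsum : M i i + ∑ j ∈ Finset.univ.erase i, M i j = 1 := by
      rw [Finset.add_sum_erase _ _ (Finset.mem_univ i)]
      exact sum_spectralMatrix d a x i
    have hle := Finset.sum_le_card_nsmul (Finset.univ.erase i) (fun j => M i j) (1 / m)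
      fun j hj => hoffle i j (Finset.ne_of_mem_erase hj).symm
    rw [Finset.card_erase_of_mem (Finset.mem_univ i), Finset.card_univ, Fintype.card_fin,
      nsmul_eq_mul, Nat.cast_pred (Nat.pos_of_ne_zero (NeZero.ne m))] at hle
    have : ((m : ℝ) - 1) * (1 / m) < 1 := by
      rw [mul_one_div, div_lt_one hm]
      linarith
    linarith
  have hpos : ∀ i j, 0 < M i j := by
    intro i j
    by_cases hij : i = j
    · exact hij ▸ hdiag i
    · exact hoffpos i j hij
  have hMst : M ∈ Matrix.rowStochastic ℝ (Fin m) :=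
    Matrix.mem_rowStochastic_iff_sum.2 ⟨fun i j => (hpos i j).le, sum_spectralMatrix d a x⟩
  have hδ : 4 * Real.exp κ * (4 / 3 * t) / (2 / 3 * γ) = 8 * Real.exp κ * t / γ := by
    field_simp
    ring
  obtain ⟨b, hb, hbn⟩ := exists_isSpectralEstimate hMst hpos hβ hκ hbal
    (by positivity : 0 < 2 / 3 * γ) hPg hMP (by positivity) (by
      rw [hδ, div_le_iff₀ hγ]
      linarith)
  refine ⟨b, hb, hbn.trans (le_of_eq ?_)⟩
  rw [hδ]
  ring

end SpectralEstimate

/-! ### The range `κ`, the discordance `γ`, and the union bound over pairs. -/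

section Parameters

lemma abs_sub_le_itemRange {m : ℕ} (β : Fin m → ℝ) (i j : Fin m) : |β i - β j| ≤ itemRange β :=
  (le_ciSup (f := fun j => |β i - β j|) (Set.finite_range _).bddAbove j).trans
    (le_ciSup (f := fun i => ⨆ j, |β i - β j|) (Set.finite_range _).bddAbove i)

variable {Ω : Type*} [MeasurableSpace Ω] {μ : Measure Ω} [IsProbabilityMeasure μ] {n m : ℕ}
  {p : ℝ} {θ : Fin n → ℝ} {βs : Fin m → ℝ} {A X : Fin n → Fin m → Ω → Bool}

lemma IsRaschModel.minDiscordance_le (h : IsRaschModel μ p θ βs A X) (l : Fin n) {i j : Fin m}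
    (hij : i ≠ j) : minDiscordance μ X ≤ discordance (θ l) (βs i) (βs j) := by
  rw [← h.integral_discordance hij l]
  exact (ciInf_le (Set.finite_range _).bddBelow l).trans
    (ciInf_le (Set.finite_range _).bddBelow (⟨(i, j), hij⟩ : {e : Fin m × Fin m // e.1 ≠ e.2}))

/-- Infima over finite nonempty families are attained at a positive value. An empty infimum in `ℝ`
would be `0`, whence the conditions on `n` and `m`. -/
lemma IsRaschModel.minDiscordance_pos (h : IsRaschModel μ p θ βs A X) (hn : 0 < n) (hm : 2 ≤ m) :
    0 < minDiscordance μ X := by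
  have : Nonempty (Fin n) := ⟨⟨0, hn⟩⟩
  have : Nonempty {e : Fin m × Fin m // e.1 ≠ e.2} :=
    ⟨⟨(⟨0, by omega⟩, ⟨1, by omega⟩), by simp⟩⟩
  obtain ⟨l, hl⟩ := exists_eq_ciInf_of_finite (f := fun l : Fin n =>
    ⨅ e : {e : Fin m × Fin m // e.1 ≠ e.2},
      ∫ ω, bit (X l e.1.1 ω) * (1 - bit (X l e.1.2 ω)) ∂μ)
  obtain ⟨e, he⟩ := exists_eq_ciInf_of_finite (f := fun e : {e : Fin m × Fin m // e.1 ≠ e.2} =>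
    ∫ ω, bit (X l e.1.1 ω) * (1 - bit (X l e.1.2 ω)) ∂μ)
  rw [minDiscordance, ← hl, ← he, h.integral_discordance e.2]
  exact discordance_pos _ _ _

/-- Uniform concentration of the pairwise comparison counts. -/
lemma IsRaschModel.measureReal_exists_count_deviation_le (h : IsRaschModel μ p θ βs A X)
    {N t : ℝ} (hN : N = n * p ^ 2) (ht0 : 0 ≤ t) (ht1 : t ≤ 1) :
    μ.real {ω | ∃ i j, i ≠ j ∧ 2 * t * N ≤
        |∑ l, bit (A l i ω) * bit (A l j ω) * (bit (X l i ω) * (1 - bit (X l j ω)))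
          - ∑ l, p ^ 2 * discordance (θ l) (βs i) (βs j)|}
      ≤ (m : ℝ) ^ 2 * (2 * Real.exp (-(t ^ 2 * N))) := by
  let B : Fin m × Fin m → Set Ω := fun e => {ω | e.1 ≠ e.2 ∧ 2 * t * N ≤
    |∑ l, bit (A l e.1 ω) * bit (A l e.2 ω) * (bit (X l e.1 ω) * (1 - bit (X l e.2 ω)))
      - ∑ l, p ^ 2 * discordance (θ l) (βs e.1) (βs e.2)|}
  have hB : ∀ e, μ.real (B e) ≤ 2 * Real.exp (-(t ^ 2 * N)) := by
    rintro ⟨i, j⟩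
    by_cases hij : i = j
    · have : B (i, j) = ∅ := by
        ext ω
        simp [B, hij]
      rw [this, measureReal_empty]
      positivity
    · have hsum : ∑ l, μ.real (discordantEvent A X i j l) ≤ N := by
        simp_rw [h.measureReal_discordantEvent hij]
        have := Finset.sum_le_card_nsmul Finset.univ
          (fun l => p ^ 2 * discordance (θ l) (βs i) (βs j)) (p ^ 2)
          fun l _ => mul_le_of_le_one_right (sq_nonneg p) (discordance_le_one _ _ _)
        rw [Finset.card_univ, Fintype.card_fin, nsmul_eq_mul] at this
        rwa [hN]
      refine le_trans (measureReal_mono ?_) (measureReal_abs_sum_indicator_sub_le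
        (h.measurableSet_discordantEvent i j) (h.iIndepSet_discordantEvent hij) hsum ht0 ht1)
      intro ω hω
      rw [Set.mem_ofPred_eq, sum_indicator_discordantEvent]
      simp_rw [h.measureReal_discordantEvent hij]
      exact hω.2
  have hsub : {ω | ∃ i j, i ≠ j ∧ 2 * t * N ≤
        |∑ l, bit (A l i ω) * bit (A l j ω) * (bit (X l i ω) * (1 - bit (X l j ω)))
          - ∑ l, p ^ 2 * discordance (θ l) (βs i) (βs j)|} ⊆ ⋃ e, B e := by
    rintro ω ⟨i, j, hω⟩
    exact Set.mem_iUnion.2 ⟨(i, j), hω⟩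
  refine (measureReal_mono hsub).trans ((measureReal_iUnion_fintype_le _).trans ?_)
  refine (Finset.sum_le_card_nsmul _ _ _ fun e _ => hB e).trans (le_of_eq ?_)
  rw [Finset.card_univ, Fintype.card_prod, Fintype.card_fin, nsmul_eq_mul]
  push_cast
  ring

end Parameters

/-! ### Numerical comparison with the stated rates. -/

section Bounds

/-- As `N` and `m` are at most `exp L`, the union bound factor `m ^ 2` costs `exp (2 * L)` and
leaves `exp (-(10 * L))`. -/
lemma sq_mul_exp_le_min {N m L : ℝ} (hN : 0 < N) (hm : 0 < m)
    (hL : L = max (Real.log N) (Real.log m)) :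
    m ^ 2 * (2 * Real.exp (-(12 * L))) ≤ 2 * min ((N ^ 10)⁻¹) ((m ^ 10)⁻¹) := by
  have hmL : m ≤ Real.exp L := by
    rw [← Real.log_le_iff_le_exp hm, hL]
    exact le_max_right _ _
  have hNL : N ≤ Real.exp L := by
    rw [← Real.log_le_iff_le_exp hN, hL]
    exact le_max_left _ _
  have hmin : Real.exp (-(10 * L)) ≤ min ((N ^ 10)⁻¹) ((m ^ 10)⁻¹) := by
    have h10 : Real.exp (-(10 * L)) = (Real.exp L ^ 10)⁻¹ := by
      rw [← Real.exp_nat_mul, Real.exp_neg]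
      norm_num
    rw [h10]
    exact le_min (inv_anti₀ (by positivity) (by gcongr)) (inv_anti₀ (by positivity) (by gcongr))
  have hsq : m ^ 2 ≤ Real.exp (2 * L) := by
    have : Real.exp (2 * L) = Real.exp L ^ 2 := by
      rw [← Real.exp_nat_mul]
      norm_num
    rw [this]
    gcongr
  calc m ^ 2 * (2 * Real.exp (-(12 * L)))
      ≤ Real.exp (2 * L) * (2 * Real.exp (-(12 * L))) :=
        mul_le_mul_of_nonneg_right hsq (by positivity)
    _ = 2 * Real.exp (-(10 * L)) := by
        rw [mul_left_comm, ← Real.exp_add]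
        ring_nf
    _ ≤ _ := by linarith

/-- Squaring requires `16² · 12 = 3072 ≤ 4000`, with `exp (2κ) ≤ exp (4κ)` and `γ ^ 3 ≤ γ ^ 2`. -/
lemma sixteen_mul_sqrt_le {κ γ N L : ℝ} (hκ : 0 ≤ κ) (hγ : 0 < γ) (hγ1 : γ ≤ 1) (hN : 0 < N)
    (hL : 0 ≤ L) (hlarge : Real.exp (4 * κ) * 4000 / γ ^ 3 * L ≤ N) :
    16 * Real.exp κ * √(12 * L / N) ≤ γ := by
  have hK : 1 ≤ Real.exp κ := Real.one_le_exp hκ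
  have hK4 : Real.exp (4 * κ) = Real.exp κ ^ 4 := by
    rw [← Real.exp_nat_mul]
    norm_num
  have h1 : Real.exp κ ^ 2 ≤ Real.exp κ ^ 4 := pow_le_pow_right₀ hK (by norm_num)
  have h2 : γ ^ 3 ≤ γ ^ 2 := pow_le_pow_of_le_one hγ.le hγ1 (by norm_num)
  have h3 : Real.exp κ ^ 4 * 4000 * L ≤ N * γ ^ 3 := by
    rwa [hK4, div_mul_eq_mul_div, div_le_iff₀ (by positivity)] at hlarge
  have h4 : Real.exp κ ^ 2 * (3072 * L) ≤ N * γ ^ 2 := by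
    have a1 : Real.exp κ ^ 2 * (3072 * L) ≤ Real.exp κ ^ 4 * (4000 * L) :=
      mul_le_mul h1 (by linarith) (by positivity) (by positivity)
    have a2 : N * γ ^ 3 ≤ N * γ ^ 2 := mul_le_mul_of_nonneg_left h2 hN.le
    linarith
  rw [← abs_of_pos hγ, ← Real.sqrt_sq_eq_abs]
  refine Real.le_sqrt_of_sq_le ?_
  rw [mul_pow, Real.sq_sqrt (by positivity), mul_pow, mul_div_assoc', div_le_iff₀ hN]
  linarith

/-- With `√12 ≤ 4` the left side is at most `64 exp κ / γ * √L / √N`. The first term on the right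
contributes at least `12 · 6 = 72` of the same quantity, and the term in `r` is nonnegative. -/
lemma error_le {κ γ N L r : ℝ} (hN : 0 ≤ N) (hκ : 0 ≤ κ) (hγ : 0 < γ) (hγ1 : γ ≤ 1)
    (hr : 0 ≤ r) :
    16 * Real.exp κ * √(12 * L / N) / γ ≤
      4 * Real.exp (2 * κ) / (γ / 3 * (1 - γ / (12 * Real.exp (2 * κ)))) *
        (2 * 3 / √γ * (√L / √N) +
          (1 + γ / (12 * Real.exp (2 * κ))) / (γ / (6 * Real.exp (2 * κ))) * r) := by
  have hK : 1 ≤ Real.exp κ := Real.one_le_exp hκ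
  have hK2 : Real.exp κ ≤ Real.exp (2 * κ) := Real.exp_le_exp.2 (by linarith)
  have hu0 : 0 ≤ γ / (12 * Real.exp (2 * κ)) := by positivity
  have hu1 : γ / (12 * Real.exp (2 * κ)) < 1 := by
    rw [div_lt_one (by positivity)]
    linarith
  have hsq : √(12 * L / N) ≤ 4 * (√L / √N) := by
    rw [mul_div_assoc, Real.sqrt_mul (by norm_num), Real.sqrt_div' _ hN]
    refine mul_le_mul_of_nonneg_right ?_ (by positivity)
    exact Real.sqrt_le_iff.2 ⟨by norm_num, by norm_num⟩
  have hfac : 12 * Real.exp κ / γ ≤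
      4 * Real.exp (2 * κ) / (γ / 3 * (1 - γ / (12 * Real.exp (2 * κ)))) := by
    rw [div_le_div_iff₀ hγ (mul_pos (by positivity) (by linarith))]
    have : γ / 3 * (1 - γ / (12 * Real.exp (2 * κ))) ≤ γ / 3 :=
      mul_le_of_le_one_right (by positivity) (by linarith)
    have h1 := mul_le_mul_of_nonneg_left this (by positivity : 0 ≤ 12 * Real.exp κ)
    have h2 := mul_le_mul_of_nonneg_right hK2 hγ.le
    linarith
  have hinner : 6 * (√L / √N) ≤ 2 * 3 / √γ * (√L / √N) +
      (1 + γ / (12 * Real.exp (2 * κ))) / (γ / (6 * Real.exp (2 * κ))) * r := by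
    have h1 : (6 : ℝ) ≤ 2 * 3 / √γ := by
      rw [le_div_iff₀ (Real.sqrt_pos.2 hγ)]
      have : √γ ≤ 1 := Real.sqrt_le_one.2 hγ1
      linarith
    have h2 := mul_le_mul_of_nonneg_right h1 (by positivity : 0 ≤ √L / √N)
    have h3 : 0 ≤ (1 + γ / (12 * Real.exp (2 * κ))) / (γ / (6 * Real.exp (2 * κ))) * r := by
      positivity
    linarith
  refine le_trans ?_ (mul_le_mul hfac hinner (by positivity) (le_trans (by positivity) hfac))
  have h1 := mul_le_mul_of_nonneg_left hsq (by positivity : 0 ≤ 16 * Real.exp κ / γ)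
  have h2 : 0 ≤ Real.exp κ / γ * (√L / √N) := by positivity
  have h3 : 16 * Real.exp κ * √(12 * L / N) / γ = 16 * Real.exp κ / γ * √(12 * L / N) := by ring
  rw [h3]
  refine h1.trans ?_
  have h4 : 16 * Real.exp κ / γ * (4 * (√L / √N)) = 64 * (Real.exp κ / γ * (√L / √N)) := by ring
  have h5 : 12 * Real.exp κ / γ * (6 * (√L / √N)) = 72 * (Real.exp κ / γ * (√L / √N)) := by ring
  rw [h4, h5]
  linarith

end Bounds

/-- Entrywise error of the spectral estimate in the Rasch model, with no assumption on the growth of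
`m`. The norm on `Fin m → ℝ` is the supremum norm. Here `N = n * p ^ 2` and
`L = max (log N) (log m)`. -/
theorem mainTheorem1 :
    ∃ C₀ C₁ C₂ C₃ C₄ : ℝ, 0 < C₀ ∧ 0 < C₁ ∧ 0 < C₂ ∧ 0 < C₃ ∧ 0 < C₄ ∧
      ∀ (n m : ℕ) (_ : 2 ≤ m) (p : ℝ) (_ : 0 < p) (_ : p ≤ 1)
        (θ : Fin n → ℝ) (βs : Fin m → ℝ) (_ : ∑ i, βs i = 0)
        (Ω : Type*) [MeasurableSpace Ω] (μ : Measure Ω) [IsProbabilityMeasure μ]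
        (A X : Fin n → Fin m → Ω → Bool) (_ : IsRaschModel μ p θ βs A X)
        (κ γ N L : ℝ) (_ : κ = itemRange βs) (_ : γ = minDiscordance μ X)
        (_ : N = n * p ^ 2) (_ : L = max (Real.log N) (Real.log m)),
        N > max (C₀ * Real.log m)
            (max (C₁ ^ 2 / γ * L)
              (max (Real.exp (4 * κ) * C₂ / γ ^ 3 * L)
                (C₄ * Real.exp (6 * κ) / γ ^ 4 * L))) →
        μ.real {ω | ∃ b : Fin m → ℝ,
            IsSpectralEstimate
              (spectralMatrix (3 * m * n * p ^ 2 / 2) (fun l i => A l i ω) (fun l i => X l i ω)) b ∧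
            ‖b - βs‖ ≤
              4 * Real.exp (2 * κ) / (γ / 3 * (1 - γ / (12 * Real.exp (2 * κ)))) *
                (2 * C₁ / √γ * (√L / √N) +
                  (1 + γ / (12 * Real.exp (2 * κ))) / (γ / (6 * Real.exp (2 * κ))) *
                    (C₃ * √(max (Real.log N / m) 1) / √N))} ≥
          1 - 2 * Real.exp (-N / 24) - 2 * min ((N ^ 10)⁻¹) (((m : ℝ) ^ 10)⁻¹)
            - min (Real.exp (-40 * m)) ((N ^ 40)⁻¹) := by
  refine ⟨1, 3, 4000, 1, 1, by norm_num, by norm_num, by norm_num, by norm_num, by norm_num, ?_⟩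
  intro n m hm p hp _ θ βs hβ Ω _ μ _ A X h κ γ N L hκ hγ hN hL hbig
  have : NeZero m := ⟨by omega⟩
  have hm2 : (2 : ℝ) ≤ m := by exact_mod_cast hm
  have hlogm : 0 < Real.log m := Real.log_pos (by linarith)
  have hLpos : 0 < L := hL ▸ hlogm.trans_le (le_max_right _ _)
  obtain ⟨hN0, hbig⟩ := max_lt_iff.1 hbig
  have hNpos : 0 < N := by linarith
  have hn : 0 < n := by
    rcases Nat.eq_zero_or_pos n with h0 | h0
    · rw [hN, h0] at hNpos
      simp at hNpos
    · exact h0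
  have hγpos : 0 < γ := hγ ▸ h.minDiscordance_pos hn hm
  have hγle : ∀ l i j, i ≠ j → γ ≤ discordance (θ l) (βs i) (βs j) :=
    fun l i j hij => hγ ▸ h.minDiscordance_le l hij
  have hγ1 : γ ≤ 1 :=
    (hγle ⟨0, hn⟩ ⟨0, by omega⟩ ⟨1, by omega⟩ (by simp)).trans (discordance_le_one _ _ _)
  have hκle : ∀ i j, |βs i - βs j| ≤ κ := fun i j => hκ ▸ abs_sub_le_itemRange βs i j
  have hκ0 : 0 ≤ κ := (abs_nonneg _).trans (hκle 0 0)
  -- Chosen so that `t ^ 2 * N = 12 * L`: two units of `L` pay for the union bound, ten for the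
  -- probability.
  set t : ℝ := √(12 * L / N) with ht
  have hsmall : 16 * Real.exp κ * t ≤ γ := sixteen_mul_sqrt_le hκ0 hγpos hγ1 hNpos hLpos.le
    (max_lt_iff.1 (max_lt_iff.1 hbig).2).1.le
  have ht0 : 0 ≤ t := Real.sqrt_nonneg _
  have ht1 : t ≤ 1 := by nlinarith [Real.one_le_exp hκ0]
  have htN : t ^ 2 * N = 12 * L := by
    rw [ht, Real.sq_sqrt (by positivity)]
    field_simp
  have hbad := h.measureReal_exists_count_deviation_le hN ht0 ht1
  rw [htN] at hbad
  have hbad' := hbad.trans (sq_mul_exp_le_min hNpos (by linarith) hL)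
  set bad : Set Ω := {ω | ∃ i j, i ≠ j ∧ 2 * t * N ≤
        |∑ l, bit (A l i ω) * bit (A l j ω) * (bit (X l i ω) * (1 - bit (X l j ω)))
          - ∑ l, p ^ 2 * discordance (θ l) (βs i) (βs j)|}
  set good : Set Ω := {ω | ∃ b : Fin m → ℝ, _}
  -- Covering and subadditivity avoid any measurability of `good`.
  have hcover : (Set.univ : Set Ω) ⊆ good ∪ bad := by
    intro ω _
    by_cases hω : ω ∈ bad
    · exact Or.inr hω
    · left
      obtain ⟨b, hb, hbn⟩ := exists_isSpectralEstimate_of_counts hβ hκle hN hNpos hγpos hγ1 hγle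
        ht0 hsmall (a := fun l i => A l i ω) (x := fun l i => X l i ω) fun i j hij =>
          le_of_not_ge fun hcon => hω ⟨i, j, hij, hcon⟩
      exact ⟨b, hb, hbn.trans (error_le hNpos.le hκ0 hγpos hγ1 (by positivity))⟩
  have h1 : (1 : ℝ) ≤ μ.real good + μ.real bad := by
    rw [← probReal_univ (μ := μ)]
    exact (measureReal_mono hcover).trans (measureReal_union_le _ _)
  have h2 : 0 ≤ Real.exp (-N / 24) := (Real.exp_pos _).le
  have h3 : 0 ≤ min (Real.exp (-40 * m)) ((N ^ 40)⁻¹) := by positivity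
  linarith
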